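/- All rings are commutative with identity. Let $S$ be a local Noetherian ring, let $K$ be an $S$-module, and let $C$ be a multiplicatively closed subset of $S$ (with $1\in C$) whose elements are nonzerodivisors of $S$ and on $K$. Let $R$ be a subring of $S$ that is twisted by $K$ along $C$, i.e. there is a derivation $D:S_C\to K_C$ with $D(c)=0$ for all $c\in C$ such that (a) $R=S\cap D^{-1}(K)$; (b) $D(S_C)$ generates $K_C$ as an $S_C$-module; and (c) $S\subseteq \operatorname{Ker} D+cS$ for all $c\in C$. Assume that $R$ is also a local Noetherian ring and that the residue fields of $R$ and $S$ are infinite. For ideals $J\subseteq I$ of a ring $A$, $J$ is a reduction of $I$ if $I^{n+1}=JI^n$ for some $n>0$; the reduction number of $I$ with respect to the reduction $J$ is the smallest integer $n\ge 0$ with $I^{n+1}=JI^n$; and a reduction $J$ of $I$ is minimal if $J$ itself has no proper reduction. Let $r_A(I)$ be the minimum of the reduction numbers of $I$ with respect to its minimal reductions. Let $I$ be an ideal of $R$ with $I=IS\cap R$ and $I\cap C\neq\emptyset$. If $J$ is a minimal reduction of $IS$ and $n\ge 0$ is an integer such that $(IS)^{n+1}=J(IS)^n$, then there exists a minimal reduction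 $J'$ of $I$ such that $I^{n+2}=J'I^{n+1}$. Moreover, $IS$ and $I$ have minimal reductions, and $$r_S(IS)\le r_R(I)\le r_S(IS)+1.$$ -/

import Mathlib

/-- `J` is a reduction of the ideal `I`: `J ⊆ I` and `I ^ (n + 1) = J * I ^ n` for some `n > 0`. -/
def IsReduction {A : Type*} [CommRing A] (J I : Ideal A) : Prop :=
  J ≤ I ∧ ∃ n : ℕ, 0 < n ∧ I ^ (n + 1) = J * I ^ n

/-- A minimal reduction of `I` is a reduction of `I` that itself has no proper reduction. -/
def IsMinimalReduction {A : Type*} [CommRing A] (J I : Ideal A) : Prop :=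
  IsReduction J I ∧ ∀ J₀ : Ideal A, IsReduction J₀ J → J₀ = J

/-- The reduction number of `I` with respect to a reduction `J`: the smallest natural number `n`
(`n = 0` allowed) with `I ^ (n + 1) = J * I ^ n`. -/
noncomputable def reductionNumberWrt {A : Type*} [CommRing A] (J I : Ideal A) : ℕ :=
  sInf {n : ℕ | I ^ (n + 1) = J * I ^ n}

/-- `r_A(I)`: the minimum of the reduction numbers of `I` with respect to its minimal
reductions. -/
noncomputable def reductionNumber {A : Type*} [CommRing A] (I : Ideal A) : ℕ :=
  sInf {r : ℕ | ∃ J : Ideal A, IsMinimalReduction J I ∧ reductionNumberWrt J I = r}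

/-- The derivation `D : S_C → K_C` twists the subring `R` of `S` by `K` along `C`. -/
structure TwistsAlong {S : Type*} [CommRing S] {K : Type*} [AddCommGroup K] [Module S K]
    (C : Submonoid S) (D : Derivation ℤ (Localization C) (LocalizedModule C K))
    (R : Subring S) : Prop where
  /-- The elements of `C` are nonzerodivisors of `S`. -/
  le_nonZeroDivisors : C ≤ nonZeroDivisors S
  /-- The elements of `C` are nonzerodivisors on `K`. -/
  torsionFree : ∀ c ∈ C, ∀ k : K, c • k = 0 → k = 0
  /-- `D` is `C`-linear. -/
  map_eq_zero : ∀ c ∈ C, D (algebraMap S (Localization C) c) = 0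
  /-- `R = S ∩ D⁻¹(K)`. -/
  mem_iff : ∀ s : S, s ∈ R ↔
    ∃ k : K, D (algebraMap S (Localization C) s) = LocalizedModule.mkLinearMap C K k
  /-- `D(S_C)` generates `K_C` as an `S_C`-module. -/
  span_range : Submodule.span (Localization C) (Set.range D) = ⊤
  /-- `S ⊆ Ker D + cS` for all `c ∈ C`. -/
  exists_add_mul : ∀ c ∈ C, ∀ s : S, ∃ a t : S,
    D (algebraMap S (Localization C) a) = 0 ∧ s = a + c * t

/-- The subring `R` of `S` is twisted by `K` along `C`. -/
def IsTwistedAlong {S : Type*} [CommRing S] (K : Type*) [AddCommGroup K] [Module S K]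
    (C : Submonoid S) (R : Subring S) : Prop :=
  ∃ D : Derivation ℤ (Localization C) (LocalizedModule C K), TwistsAlong C D R

open IsLocalRing

/-! ### Reductions and integral dependence. -/

section Reductions

variable {A : Type*} [CommRing A]

/-! Modulo `K`, `D` is a map from `S` with kernel `R`; it is onto `K_C / K`, and `S = R + gS` for `g
∈ C`. Suppose `(IS)^(n+1) = J(IS)^n` with `J ⊆ I` an ideal of `R`. For `x ∈ I^(n+2)` write `x = p +
gw` with `p ∈ J I^(n+1)`. By Leibniz `D(x - p)` lies in `(IS)^(n+1) K = J(IS)^n K`, one power lower.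
Modulo `gK` it is the derivative of some `y = gs ∈ J I^(n+1)`, so `w - s ∈ R` and `x ∈ J I^(n+1) +
gR` (`pow_le_mul_sup_span`). For `g` a high power of `c ∈ I ∩ C`, Nakayama removes `gR`
(`pow_eq_mul`). Being a reduction depends only on the image modulo `𝔪 I`. If `c` is a nonunit of
`S`, then `c²S ⊆ 𝔪_S IS`, so generators of a minimal reduction of `IS` can be moved into `R`. This
lifts minimal reductions to `R` and shows that those of `I` extend to minimal ones, giving the two
inequalities. -/

theorem pow_succ_add_eq_mul {J I : Ideal A} {n : ℕ} (h : I ^ (n + 1) = J * I ^ n) (k : ℕ) :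
    I ^ (n + k + 1) = J * I ^ (n + k) := by
  rw [show n + k + 1 = n + 1 + k by ring, pow_add, h, mul_assoc, ← pow_add]

theorem pow_add_eq_pow_mul {J I : Ideal A} {n : ℕ} (h : I ^ (n + 1) = J * I ^ n) (k : ℕ) :
    I ^ (n + k) = J ^ k * I ^ n := by
  induction k with
  | zero => simp
  | succ k ih => rw [← add_assoc, pow_succ_add_eq_mul h, ih, pow_succ', mul_assoc]

theorem IsReduction.of_pow_eq {J I : Ideal A} (hJ : J ≤ I) {n : ℕ}
    (h : I ^ (n + 1) = J * I ^ n) : IsReduction J I :=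
  ⟨hJ, n + 1, n.succ_pos, pow_succ_add_eq_mul h 1⟩

theorem IsReduction.refl (I : Ideal A) : IsReduction I I :=
  .of_pow_eq le_rfl (n := 0) (by simp)

theorem IsReduction.trans {L J I : Ideal A} (h₁ : IsReduction L J) (h₂ : IsReduction J I) :
    IsReduction L I := by
  obtain ⟨hLJ, m, -, hm⟩ := h₁
  obtain ⟨hJI, n, -, hn⟩ := h₂
  refine .of_pow_eq (hLJ.trans hJI) (n := n + m) ?_
  rw [add_assoc, pow_add_eq_pow_mul hn, hm, mul_assoc, ← pow_add_eq_pow_mul hn]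

theorem IsReduction.map {B : Type*} [CommRing B] (f : A →+* B) {J I : Ideal A}
    (h : IsReduction J I) : IsReduction (J.map f) (I.map f) := by
  obtain ⟨hJI, n, hn, h⟩ := h
  refine ⟨Ideal.map_mono hJI, n, hn, ?_⟩
  rw [← Ideal.map_pow, h, Ideal.map_mul, Ideal.map_pow]

theorem sup_pow_succ_le (L X : Ideal A) (k : ℕ) :
    (L ⊔ X) ^ (k + 1) ≤ L * (L ⊔ X) ^ k ⊔ X ^ (k + 1) := by
  induction k with
  | zero => simp
  | succ k ih =>
    rw [pow_succ' _ (k + 1), Ideal.sup_mul]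
    refine sup_le le_sup_left ?_
    calc X * (L ⊔ X) ^ (k + 1) ≤ X * (L * (L ⊔ X) ^ k ⊔ X ^ (k + 1)) := Ideal.mul_mono_right ih
      _ ≤ _ := by
        rw [Ideal.mul_sup]
        refine sup_le_sup ?_ (by rw [← pow_succ'])
        rw [mul_left_comm, pow_succ' (L ⊔ X)]
        exact Ideal.mul_mono_right (Ideal.mul_mono_left le_sup_right)

theorem IsReduction.sup_span_singleton {L : Ideal A} {x : A} {k : ℕ}
    (h : x ^ (k + 1) ∈ L * (L ⊔ Ideal.span {x}) ^ k) : IsReduction L (L ⊔ Ideal.span {x}) := by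
  refine .of_pow_eq le_sup_left (n := k) (le_antisymm ?_ ?_)
  · refine (sup_pow_succ_le _ _ _).trans (sup_le le_rfl ?_)
    rwa [Ideal.span_singleton_pow, Ideal.span_singleton_le_iff_mem]
  · rw [pow_succ']
    exact Ideal.mul_mono_left le_sup_left

/-- An ideal `J` is reduced by a subideal over which each of its elements is integral. -/
theorem IsReduction.of_forall_pow_mem {L J : Ideal A} (hL : L ≤ J) (hJ : J.FG)
    (h : ∀ x ∈ J, ∃ k : ℕ, x ^ (k + 1) ∈ L * (L ⊔ Ideal.span {x}) ^ k) : IsReduction L J := by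
  classical
  have key : ∀ s : Finset A, (s : Set A) ⊆ J → IsReduction L (L ⊔ Ideal.span s) := by
    intro s
    induction s using Finset.induction_on with
    | empty => intro _; simpa using IsReduction.refl L
    | insert a s _ ih =>
      intro hs
      rw [Finset.coe_insert, Set.insert_subset_iff] at hs
      obtain ⟨k, hk⟩ := h a hs.1
      refine (ih hs.2).trans ?_
      rw [Finset.coe_insert, Ideal.span_insert, sup_comm (Ideal.span {a}), ← sup_assoc]
      refine IsReduction.sup_span_singleton (k := k) ?_
      exact Ideal.mul_mono le_sup_left (Ideal.pow_right_mono (sup_le_sup_right le_sup_left _) k) hk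
  obtain ⟨s, rfl⟩ := hJ
  have := key s Ideal.subset_span
  rwa [show L ⊔ Ideal.span (s : Set A) = Ideal.span s from sup_eq_right.2 hL] at this

/-- The determinant trick: the elements of `I` are integral over a reduction of `I`. -/
theorem IsReduction.exists_pow_mem [IsNoetherianRing A] {L I : Ideal A} (h : IsReduction L I)
    {x : A} (hx : x ∈ I) : ∃ k : ℕ, x ^ (k + 1) ∈ L * (L ⊔ Ideal.span {x}) ^ k := by
  obtain ⟨-, n, hn, h⟩ := h
  have hrange : LinearMap.range (algebraMap A (Module.End A ↥(I ^ n)) x) ≤ L • ⊤ := by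
    rintro _ ⟨y, rfl⟩
    rw [Submodule.mem_smul_top_iff, smul_eq_mul, ← h, pow_succ']
    exact Ideal.mul_mem_mul hx y.2
  obtain ⟨p, hmonic, -, hcoeff, hp⟩ :=
    LinearMap.exists_monic_and_natDegree_eq_and_coeff_mem_pow_and_aeval_eq_zero A _ L hrange
  rw [Polynomial.aeval_algebraMap_apply] at hp
  -- Cayley-Hamilton for `x` acting on `I ^ n`, evaluated at `x ^ n`; no faithfulness is needed.
  have h0 : Polynomial.aeval x p * x ^ n = 0 :=
    congrArg Subtype.val (LinearMap.congr_fun hp ⟨x ^ n, Ideal.pow_mem_pow hx n⟩)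
  set d := p.natDegree with hd
  have hsum : x ^ (d + n) = -∑ k ∈ Finset.range d, p.coeff k * x ^ (k + n) := by
    rw [Polynomial.aeval_eq_sum_range, Finset.sum_range_succ, ← hd,
      hd, hmonic.coeff_natDegree, ← hd, add_mul, Finset.sum_mul] at h0
    simp only [smul_eq_mul, one_mul] at h0
    rw [pow_add, eq_neg_iff_add_eq_zero, add_comm, ← h0]
    congr 1
    exact Finset.sum_congr rfl fun k _ => by ring
  refine ⟨d + n - 1, ?_⟩
  rw [Nat.sub_add_cancel (by omega), hsum]
  refine neg_mem (sum_mem fun k hk => ?_)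
  have hk := Finset.mem_range.1 hk
  have h1 := hcoeff k
  rw [show d - k = (d - k - 1) + 1 by omega, pow_succ'] at h1
  have h2 : p.coeff k * x ^ (k + n) ∈ L * L ^ (d - k - 1) * (L ⊔ Ideal.span {x}) ^ (k + n) :=
    Ideal.mul_mem_mul h1 (Ideal.pow_mem_pow
      (Ideal.mem_sup_right (Ideal.mem_span_singleton_self x)) _)
  rw [mul_assoc] at h2
  refine Ideal.mul_mono_right ?_ h2
  calc L ^ (d - k - 1) * (L ⊔ Ideal.span {x}) ^ (k + n)
      ≤ (L ⊔ Ideal.span {x}) ^ (d - k - 1) * (L ⊔ Ideal.span {x}) ^ (k + n) :=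
        Ideal.mul_mono_left (Ideal.pow_right_mono le_sup_left _)
    _ = _ := by rw [← pow_add]; congr 1; omega

theorem IsReduction.of_le [IsNoetherianRing A] {L J I : Ideal A} (h : IsReduction L I)
    (hLJ : L ≤ J) (hJI : J ≤ I) : IsReduction L J :=
  .of_forall_pow_mem hLJ (IsNoetherian.noetherian J) fun _ hx => h.exists_pow_mem (hJI hx)

theorem IsMinimalReduction.eq_of_le [IsNoetherianRing A] {J L I : Ideal A} (hJ : IsMinimalReduction J I)
    (hLJ : L ≤ J) (hL : IsReduction L I) : L = J :=
  hJ.2 L (hL.of_le hLJ hJ.1.1)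

theorem span_range_le_sup_of_sub_mem {M : Ideal A} {l : ℕ} {f g : Fin l → A}
    (hfg : ∀ i, f i - g i ∈ M) : Ideal.span (Set.range f) ≤ Ideal.span (Set.range g) ⊔ M := by
  rw [Ideal.span_le]
  rintro _ ⟨i, rfl⟩
  rw [← add_sub_cancel (g i) (f i)]
  exact add_mem (Ideal.mem_sup_left (Ideal.subset_span ⟨i, rfl⟩)) (Ideal.mem_sup_right (hfg i))

end Reductions

/-! ### Minimal reductions over a Noetherian local ring. -/

section LocalReductions

variable {A : Type*} [CommRing A] [IsLocalRing A]

/-- The residues of the family `f` in `I / 𝔪 I` are linearly independent over the residue field. -/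
def IndepModMaximal (I : Ideal A) {l : ℕ} (f : Fin l → A) : Prop :=
  ∀ a : Fin l → A, ∑ i, a i * f i ∈ maximalIdeal A * I → ∀ i, a i ∈ maximalIdeal A

theorem IndepModMaximal.congr {I : Ideal A} {l : ℕ} {f g : Fin l → A} (hf : IndepModMaximal I f)
    (hfg : ∀ i, f i - g i ∈ maximalIdeal A * I) : IndepModMaximal I g := by
  intro a ha
  refine hf a ?_
  have : ∑ i, a i * f i = ∑ i, a i * g i + ∑ i, a i * (f i - g i) := by
    rw [← Finset.sum_add_distrib]
    exact Finset.sum_congr rfl fun i _ => by ring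
  rw [this]
  exact add_mem ha (sum_mem fun i _ => Ideal.mul_mem_left _ _ (hfg i))

variable [IsNoetherianRing A]

theorem Ideal.le_of_le_sup_maximalIdeal_mul {M N : Ideal A} (h : N ≤ M ⊔ maximalIdeal A * N) :
    N ≤ M :=
  Submodule.le_of_le_smul_of_le_jacobson_bot (IsNoetherian.noetherian N)
    (maximalIdeal_le_jacobson _) h

/-- The error term `𝔪 I * I ^ n` is `𝔪 I ^ (n + 1)`, which Nakayama absorbs. -/
theorem pow_eq_mul_of_le_sup {J L I : Ideal A} (hL : L ≤ I)
    (hJL : J ≤ L ⊔ maximalIdeal A * I) {n : ℕ} (h : I ^ (n + 1) = J * I ^ n) :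
    I ^ (n + 1) = L * I ^ n := by
  refine le_antisymm (Ideal.le_of_le_sup_maximalIdeal_mul ?_) ?_
  · calc I ^ (n + 1) ≤ (L ⊔ maximalIdeal A * I) * I ^ n := h.le.trans (Ideal.mul_mono_left hJL)
      _ = _ := by rw [Ideal.sup_mul, mul_assoc, ← pow_succ']
  · rw [pow_succ']
    exact Ideal.mul_mono_left hL

theorem IsReduction.of_le_sup {J L I : Ideal A} (h : IsReduction J I) (hL : L ≤ I)
    (hJL : J ≤ L ⊔ maximalIdeal A * I) : IsReduction L I :=
  ⟨hL, h.2.imp fun _ hn => ⟨hn.1, pow_eq_mul_of_le_sup hL hJL hn.2⟩⟩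

theorem exists_indepModMaximal {J I : Ideal A} :
    ∃ (l : ℕ) (f : Fin l → A), (∀ i, f i ∈ J) ∧
      J ≤ Ideal.span (Set.range f) ⊔ maximalIdeal A * I ∧ IndepModMaximal I f := by
  classical
  have hex : ∃ (l : ℕ) (f : Fin l → A), (∀ i, f i ∈ J) ∧
      J ≤ Ideal.span (Set.range f) ⊔ maximalIdeal A * I := by
    obtain ⟨l, f, hf⟩ := Submodule.fg_iff_exists_fin_generating_family.1 (IsNoetherian.noetherian J)
    refine ⟨l, f, fun i => ?_, ?_⟩
    · rw [← hf]; exact Submodule.subset_span ⟨i, rfl⟩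
    · exact hf.ge.trans le_sup_left
  obtain ⟨f, hfJ, hf⟩ := Nat.find_spec hex
  have hmin := fun m => Nat.find_min hex (m := m)
  generalize Nat.find hex = l at f hfJ hf hmin
  refine ⟨l, f, hfJ, hf, fun a ha i => ?_⟩
  -- A unit coefficient would make one generator redundant, against the minimality of `l`.
  by_contra hai
  obtain ⟨u, hu⟩ : IsUnit (a i) := by simpa using hai
  cases l with
  | zero => exact i.elim0
  | succ l =>
    refine hmin l l.lt_succ_self ⟨f ∘ i.succAbove, fun j => hfJ _, hf.trans (sup_le ?_ le_sup_right)⟩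
    have hsucc : ∀ j, f (i.succAbove j) ∈ Ideal.span (Set.range (f ∘ i.succAbove)) :=
      fun j => Ideal.subset_span ⟨j, rfl⟩
    rw [Ideal.span_le]
    rintro _ ⟨j, rfl⟩
    rcases Fin.eq_self_or_eq_succAbove i j with rfl | ⟨j, rfl⟩
    · have : f j = (↑u⁻¹ : A) * (∑ k, a k * f k)
          - (↑u⁻¹ : A) * ∑ k, a (j.succAbove k) * f (j.succAbove k) := by
        rw [Fin.sum_univ_succAbove _ j, ← mul_sub, add_sub_cancel_right, ← hu, Units.inv_mul_cancel_left]
      rw [this]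
      refine sub_mem (Ideal.mem_sup_right (Ideal.mul_mem_left _ _ ha)) (Ideal.mem_sup_left ?_)
      exact Ideal.mul_mem_left _ _ (sum_mem fun k _ => Ideal.mul_mem_left _ _ (hsucc k))
    · exact Ideal.mem_sup_left (hsucc j)

/-- Independence gives `(f) ∩ 𝔪 I = 𝔪 (f)`, so agreement with `(f)` modulo `𝔪 I` becomes equality by
Nakayama. -/
theorem isMinimalReduction_span {I : Ideal A} {l : ℕ} {f : Fin l → A}
    (hred : IsReduction (Ideal.span (Set.range f)) I) (hf : IndepModMaximal I f)
    (hmin : ∀ L ≤ Ideal.span (Set.range f), IsReduction L I →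
      Ideal.span (Set.range f) ≤ L ⊔ maximalIdeal A * I) :
    IsMinimalReduction (Ideal.span (Set.range f)) I := by
  refine ⟨hred, fun L hL => le_antisymm hL.1 (Ideal.le_of_le_sup_maximalIdeal_mul fun x hx => ?_)⟩
  obtain ⟨y, hy, z, hz, rfl⟩ := Submodule.mem_sup.1 (hmin L hL.1 (hL.trans hred) hx)
  refine add_mem (Ideal.mem_sup_left hy) (Ideal.mem_sup_right ?_)
  have hz' : z ∈ Ideal.span (Set.range f) := (Submodule.add_mem_iff_right _ (hL.1 hy)).1 hx
  obtain ⟨a, rfl⟩ := Ideal.mem_span_range_iff_exists_fun.1 hz'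
  exact sum_mem fun i _ => Ideal.mul_mem_mul (hf a hz i) (Ideal.subset_span ⟨i, rfl⟩)

theorem isArtinian_quotient_maximalIdeal_smul (I : Ideal A) :
    IsArtinian A (I ⧸ (maximalIdeal A • ⊤ : Submodule A I)) := by
  let : Field (A ⧸ maximalIdeal A) := Ideal.Quotient.field _
  have : IsArtinian (A ⧸ maximalIdeal A) (I ⧸ (maximalIdeal A • ⊤ : Submodule A I)) :=
    have : Module.Finite (A ⧸ maximalIdeal A) (I ⧸ (maximalIdeal A • ⊤ : Submodule A I)) :=
      Module.Finite.of_restrictScalars_finite A _ _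
    inferInstance
  exact isArtinian_of_surjective_algebraMap (R := A ⧸ maximalIdeal A) Ideal.Quotient.mk_surjective

theorem IsReduction.exists_isMinimalReduction_le {J I : Ideal A} (hJ : IsReduction J I) :
    ∃ L ≤ J, IsMinimalReduction L I := by
  have := isArtinian_quotient_maximalIdeal_smul I
  let N : Ideal A → Submodule A (I ⧸ (maximalIdeal A • ⊤ : Submodule A I)) := fun L =>
    (Submodule.comap I.subtype L).map (Submodule.mkQ _)
  have hN : ∀ {L M : Ideal A}, M ≤ I → N M ≤ N L → M ≤ L ⊔ maximalIdeal A * I := by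
    intro L M hM h x hx
    obtain ⟨y, hy, hxy⟩ := h (Submodule.mem_map_of_mem (f := Submodule.mkQ _)
      (show (⟨x, hM hx⟩ : I) ∈ Submodule.comap I.subtype M from hx))
    have hxy' := (Submodule.Quotient.eq _).1 hxy.symm
    rw [Submodule.mem_smul_top_iff] at hxy'
    rw [show x = y + (x - y) by ring]
    exact add_mem (Ideal.mem_sup_left hy) (Ideal.mem_sup_right hxy')
  -- Descending chains stop in the finite-dimensional space `I / 𝔪 I`, so some reduction has minimal
  -- image there.
  obtain ⟨_, ⟨L, ⟨hLJ, hL⟩, rfl⟩, hmin⟩ := wellFounded_lt.has_min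
    (N '' {L | L ≤ J ∧ IsReduction L I}) ⟨_, J, ⟨le_rfl, hJ⟩, rfl⟩
  obtain ⟨l, f, hfL, hLf, hf⟩ := exists_indepModMaximal (J := L) (I := I)
  have hspan : Ideal.span (Set.range f) ≤ L := Ideal.span_le.2 (Set.range_subset_iff.2 hfL)
  refine ⟨_, hspan.trans hLJ, isMinimalReduction_span
    (hL.of_le_sup (hspan.trans hL.1) hLf) hf fun M hM hMI => hspan.trans (hN hL.1 ?_)⟩
  have hle : N M ≤ N L := Submodule.map_mono (Submodule.comap_mono (hM.trans hspan))
  exact (eq_of_le_of_not_lt hle (hmin _ ⟨M, ⟨hM.trans (hspan.trans hLJ), hMI⟩, rfl⟩)).ge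

theorem IsMinimalReduction.exists_generators {J I : Ideal A} (hJ : IsMinimalReduction J I) :
    ∃ (l : ℕ) (f : Fin l → A), Ideal.span (Set.range f) = J ∧ IndepModMaximal I f := by
  obtain ⟨l, f, hfJ, hJf, hf⟩ := exists_indepModMaximal (J := J) (I := I)
  have hspan : Ideal.span (Set.range f) ≤ J := Ideal.span_le.2 (Set.range_subset_iff.2 hfJ)
  exact ⟨l, f, hJ.eq_of_le hspan (hJ.1.of_le_sup (hspan.trans hJ.1.1) hJf), hf⟩

/-- Changing the generators of a minimal reduction of `I` modulo `𝔪 I` yields a minimal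
reduction. -/
theorem IsMinimalReduction.span_of_sub_mem {I : Ideal A} {l : ℕ} {f g : Fin l → A}
    (hJ : IsMinimalReduction (Ideal.span (Set.range f)) I) (hf : IndepModMaximal I f)
    (hg : ∀ i, g i ∈ I) (hfg : ∀ i, f i - g i ∈ maximalIdeal A * I) :
    IsMinimalReduction (Ideal.span (Set.range g)) I := by
  have hfg' := span_range_le_sup_of_sub_mem hfg
  have hgf' := span_range_le_sup_of_sub_mem (f := g) (g := f) fun i => by
    rw [← neg_sub]; exact neg_mem (hfg i)
  refine isMinimalReduction_span
    (hJ.1.of_le_sup (Ideal.span_le.2 (Set.range_subset_iff.2 hg)) hfg') (hf.congr hfg)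
    fun L hL hLI => ?_
  -- `L` is carried back into `(f)` modulo `𝔪 I`, where the minimality of `(f)` applies.
  have hLsup : L ≤ Ideal.span (Set.range f) ⊓ (L ⊔ maximalIdeal A * I) ⊔ maximalIdeal A * I := by
    intro x hx
    obtain ⟨j, hj, y, hy, rfl⟩ := Submodule.mem_sup.1 (hgf' (hL hx))
    refine add_mem (Ideal.mem_sup_left ⟨hj, ?_⟩) (Ideal.mem_sup_right hy)
    rw [← add_sub_cancel_right j y]
    exact sub_mem (Ideal.mem_sup_left hx) (Ideal.mem_sup_right hy)
  have heq := hJ.eq_of_le inf_le_left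
    (hLI.of_le_sup (inf_le_left.trans hJ.1.1) hLsup)
  exact hgf'.trans (sup_le (inf_eq_left.1 heq) le_sup_right)

end LocalReductions

/-! ### Reduction numbers. -/

section ReductionNumber

variable {A : Type*} [CommRing A]

theorem reductionNumberWrt_le {J I : Ideal A} {n : ℕ} (h : I ^ (n + 1) = J * I ^ n) :
    reductionNumberWrt J I ≤ n :=
  Nat.sInf_le h

theorem reductionNumber_le {J I : Ideal A} (hJ : IsMinimalReduction J I) {n : ℕ}
    (h : I ^ (n + 1) = J * I ^ n) : reductionNumber I ≤ n :=
  (Nat.sInf_le ⟨J, hJ, rfl⟩ : reductionNumber I ≤ _).trans (reductionNumberWrt_le h)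

theorem exists_pow_reductionNumber_eq {I : Ideal A} (h : ∃ J, IsMinimalReduction J I) :
    ∃ J, IsMinimalReduction J I ∧
      I ^ (reductionNumber I + 1) = J * I ^ reductionNumber I := by
  obtain ⟨J₀, hJ₀⟩ := h
  obtain ⟨J, hJ, hr⟩ := Nat.sInf_mem
    (⟨_, J₀, hJ₀, rfl⟩ : {r : ℕ | ∃ J, IsMinimalReduction J I ∧ reductionNumberWrt J I = r}.Nonempty)
  obtain ⟨n, -, hn⟩ := hJ.1.2
  refine ⟨J, hJ, ?_⟩
  have := Nat.sInf_mem (⟨n, hn⟩ : {n : ℕ | I ^ (n + 1) = J * I ^ n}.Nonempty)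
  rwa [show sInf {n : ℕ | I ^ (n + 1) = J * I ^ n} = reductionNumber I from hr] at this

theorem eq_top_of_isReduction_top {J : Ideal A} (h : IsReduction J ⊤) : J = ⊤ := by
  obtain ⟨-, n, -, h⟩ := h
  simpa [Ideal.top_pow] using h.symm

theorem isMinimalReduction_top : IsMinimalReduction (⊤ : Ideal A) ⊤ :=
  ⟨.refl _, fun _ => eq_top_of_isReduction_top⟩

theorem reductionNumber_top : reductionNumber (⊤ : Ideal A) = 0 :=
  Nat.le_zero.1 (reductionNumber_le isMinimalReduction_top (by simp))

end ReductionNumber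

/-! ### Twisted subrings: lifting equations from `S` to `R`. -/

namespace TwistsAlong

variable {S : Type*} [CommRing S] {K : Type*} [AddCommGroup K] [Module S K] {C : Submonoid S}
  {R : Subring S} {D : Derivation ℤ (Localization C) (LocalizedModule C K)}

local notation "δ" => Derivation.compAlgebraMap S D
local notation "ι" => LocalizedModule.mkLinearMap C K

theorem smul_cancel {c : S} (hc : c ∈ C) {v w : LocalizedModule C K} (h : c • v = c • w) :
    v = w :=
  IsLocalizedModule.smul_injective ι ⟨c, hc⟩ h

theorem exists_smul_eq (v : LocalizedModule C K) : ∃ c ∈ C, ∃ k, c • v = ι k := by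
  obtain ⟨⟨k, c⟩, h⟩ := IsLocalizedModule.surj C ι v
  exact ⟨c, c.2, k, h⟩

variable (hT : TwistsAlong C D R)
include hT

theorem map_eq {c : S} (hc : c ∈ C) : δ c = 0 :=
  hT.map_eq_zero c hc

theorem leibniz_left {c : S} (hc : c ∈ C) (t : S) : δ (c * t) = c • δ t := by
  rw [Derivation.leibniz, hT.map_eq hc, smul_zero, add_zero]

theorem mem_iff' {s : S} : s ∈ R ↔ ∃ k, δ s = ι k :=
  hT.mem_iff s

theorem exists_add_mul' {c : S} (hc : c ∈ C) (s : S) : ∃ a t : S, δ a = 0 ∧ s = a + c * t :=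
  hT.exists_add_mul c hc s

theorem exists_eq_add_mul {c : S} (hc : c ∈ C) (s : S) : ∃ (a : R) (t : S), s = a + c * t := by
  obtain ⟨a, t, ha, h⟩ := hT.exists_add_mul' hc s
  exact ⟨⟨a, hT.mem_iff'.2 ⟨0, by rw [ha, map_zero]⟩⟩, t, h⟩

/-- The derivation maps `S` onto `K_C / K`. -/
theorem exists_eq_add (v : LocalizedModule C K) : ∃ s k, v = δ s + ι k := by
  have hmem : v ∈ Submodule.span (Localization C) (Set.range D) := hT.span_range ▸ trivial
  -- All multiples of `v` are treated at once so that the induction survives scalars from `S_C`.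
  suffices h : ∀ x : Localization C, ∃ s k, x • v = δ s + ι k by simpa using h 1
  induction hmem using Submodule.span_induction with
  | mem v hv =>
    obtain ⟨y, rfl⟩ := hv
    intro x
    obtain ⟨⟨s, c⟩, hx⟩ := IsLocalization.surj C x
    obtain ⟨⟨t, e⟩, hy⟩ := IsLocalization.surj C y
    have hDy : (e : S) • D y = δ t := by
      have := congrArg D hy
      rw [mul_comm, Derivation.leibniz, hT.map_eq_zero _ e.2, smul_zero, add_zero,
        algebraMap_smul] at this
      exact this
    have hce : (c * e : S) • x • D y = s • δ t := by
      rw [mul_smul, ← hDy, smul_comm (e : S) x, ← smul_assoc (c : S) x, Algebra.smul_def,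
        mul_comm, hx, algebraMap_smul]
    obtain ⟨b, hb, k, hk⟩ := exists_smul_eq (δ t)
    -- The factor `b` clears the denominator of `δ t`, so the non-constant part of `s` contributes
    -- only an element of `K`.
    obtain ⟨a, s', ha, rfl⟩ := hT.exists_add_mul' (mul_mem (mul_mem c.2 e.2) hb) s
    obtain ⟨a', t', ha', rfl⟩ := hT.exists_add_mul' (mul_mem c.2 e.2) t
    rw [map_add, ha', zero_add, hT.leibniz_left (mul_mem c.2 e.2)] at hce hk
    refine ⟨a * t', s' • k, smul_cancel (mul_mem c.2 e.2) (hce.trans ?_)⟩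
    rw [Derivation.leibniz, ha, smul_zero, add_zero, map_smul, ← hk]
    module
  | zero => exact fun x => ⟨0, 0, by simp⟩
  | add v w _ _ hv hw =>
    intro x
    obtain ⟨s, k, h⟩ := hv x
    obtain ⟨s', k', h'⟩ := hw x
    exact ⟨s + s', k + k', by rw [smul_add, h, h', map_add, map_add]; abel⟩
  | smul z v _ hv => exact fun x => by simpa only [smul_smul] using hv (x * z)

/-- Split `k / g` as a derivative plus an element of `K`, then multiply back by the constant `g`. -/
theorem exists_derivation_eq {g : S} (hg : g ∈ C) (k : K) :
    ∃ (y : R) (s : S) (k' : K), (y : S) = g * s ∧ δ (y : S) = ι k + g • ι k' := by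
  obtain ⟨v, hv⟩ : ∃ v : LocalizedModule C K, g • v = ι k :=
    ⟨IsLocalizedModule.mk' ι k ⟨g, hg⟩, IsLocalizedModule.mk'_cancel' ι k ⟨g, hg⟩⟩
  obtain ⟨s, k', rfl⟩ := hT.exists_eq_add v
  have h : δ (g * s) = ι k + g • ι (-k') := by
    rw [hT.leibniz_left hg, ← hv, map_neg, smul_add, smul_neg, add_neg_cancel_right]
  exact ⟨⟨g * s, hT.mem_iff'.2 ⟨k + g • -k', by rw [h, map_add, map_smul]⟩⟩, s, -k', rfl, h⟩

theorem exists_eq_add_mul_of_mem_map {g : S} (hg : g ∈ C) {Q : Ideal R} {x : S}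
    (hx : x ∈ Q.map (algebraMap R S)) :
    ∃ q ∈ Q, ∃ w ∈ Q.map (algebraMap R S), x = (q : S) + g * w := by
  induction hx using Submodule.span_induction with
  | mem x hx =>
    obtain ⟨q, hq, rfl⟩ := hx
    exact ⟨q, hq, 0, zero_mem _, by rw [mul_zero, add_zero]; rfl⟩
  | zero => exact ⟨0, zero_mem _, 0, zero_mem _, by simp⟩
  | add x y _ _ hx hy =>
    obtain ⟨q, hq, w, hw, rfl⟩ := hx
    obtain ⟨q', hq', w', hw', rfl⟩ := hy
    exact ⟨q + q', add_mem hq hq', w + w', add_mem hw hw', by push_cast; ring⟩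
  | smul s x _ hx =>
    obtain ⟨q, hq, w, hw, rfl⟩ := hx
    obtain ⟨a, t, rfl⟩ := hT.exists_eq_add_mul hg s
    have hq' : (q : S) ∈ Q.map (algebraMap R S) := Ideal.mem_map_of_mem _ hq
    refine ⟨a * q, Ideal.mul_mem_left _ _ hq, t * q + (a + g * t) * w,
      add_mem (Ideal.mul_mem_left _ _ hq') (Ideal.mul_mem_left _ _ hw), ?_⟩
    push_cast [smul_eq_mul]
    ring

theorem derivation_mem_of_mem_pow {I : Ideal R} (m : ℕ) {x : R} (hx : x ∈ I ^ (m + 1)) :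
    δ (x : S) ∈ (((I.map (algebraMap R S)) ^ m • ⊤ : Submodule S K)).map ι := by
  induction m generalizing x with
  | zero =>
    obtain ⟨k, hk⟩ := hT.mem_iff'.1 x.2
    rw [hk]
    exact Submodule.mem_map_of_mem (by simp)
  | succ m ih =>
    rw [pow_succ] at hx
    induction hx using Submodule.mul_induction_on' with
    | mem_mul_mem y hy z hz =>
      have hy' : (y : S) ∈ (I.map (algebraMap R S)) ^ (m + 1) := by
        rw [← Ideal.map_pow]; exact Ideal.mem_map_of_mem _ hy
      have hz' : (z : S) ∈ I.map (algebraMap R S) := Ideal.mem_map_of_mem _ hz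
      obtain ⟨k, hk⟩ := hT.mem_iff'.1 z.2
      obtain ⟨k', hk', h⟩ := ih hy
      rw [Subring.coe_mul, Derivation.leibniz, hk, ← h, ← map_smul, ← map_smul]
      refine add_mem (Submodule.mem_map_of_mem (Submodule.smul_mem_smul hy' trivial))
        (Submodule.mem_map_of_mem ?_)
      rw [pow_succ', ← smul_eq_mul, Submodule.smul_assoc]
      exact Submodule.smul_mem_smul hz' hk'
    | add y _ z _ hy hz =>
      rw [Subring.coe_add, map_add]
      exact add_mem hy hz

/-- Elements of `PK` are, modulo `gK`, derivatives of elements of `P I` divisible by `g`. -/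
theorem exists_mem_mul_derivation_eq {I P : Ideal R} {g : S} (hg : g ∈ C)
    (hgI : ∀ r : R, g ∣ (r : S) → r ∈ I) {k : K}
    (hk : k ∈ (P.map (algebraMap R S) • ⊤ : Submodule S K)) :
    ∃ y ∈ P * I, ∃ (s : S) (k' : K), (y : S) = g * s ∧ δ (y : S) = ι k + g • ι k' := by
  refine Submodule.smul_induction_on hk (fun q hq k _ => ?_) ?_
  · induction hq using Submodule.span_induction generalizing k with
    | mem q hq =>
      obtain ⟨p, hp, rfl⟩ := hq
      obtain ⟨y, s, k', hy, hk'⟩ := hT.exists_derivation_eq hg k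
      obtain ⟨e, he⟩ := hT.mem_iff'.1 p.2
      -- Divisibility by `g` puts `y` in `I`; this factor restores the power lost by
      -- differentiating.
      refine ⟨p * y, Ideal.mul_mem_mul hp (hgI y ⟨s, hy⟩), p * s, (p : S) • k' + s • e, ?_, ?_⟩
      · rw [Subring.coe_mul, hy]; ring
      · change δ ((p * y : R) : S) = ι ((p : S) • k) + g • ι ((p : S) • k' + s • e)
        rw [Subring.coe_mul, Derivation.leibniz, hk', he, hy, map_add, map_smul, map_smul, map_smul]
        module
    | zero => exact ⟨0, zero_mem _, 0, 0, by simp, by simp⟩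
    | add q q' _ _ hq hq' =>
      obtain ⟨y, hy, s, e, h1, h2⟩ := hq k trivial
      obtain ⟨y', hy', s', e', h1', h2'⟩ := hq' k trivial
      refine ⟨y + y', add_mem hy hy', s + s', e + e', ?_, ?_⟩
      · rw [Subring.coe_add, h1, h1']; ring
      · rw [Subring.coe_add, map_add, h2, h2', add_smul, map_add, map_add, smul_add]; abel
    | smul a q _ hq => simpa only [smul_eq_mul, mul_comm a, mul_smul] using hq (a • k) trivial
  · rintro k₁ k₂ ⟨y, hy, s, e, h1, h2⟩ ⟨y', hy', s', e', h1', h2'⟩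
    refine ⟨y + y', add_mem hy hy', s + s', e + e', ?_, ?_⟩
    · rw [Subring.coe_add, h1, h1']; ring
    · rw [Subring.coe_add, map_add, h2, h2', map_add, map_add, smul_add]; abel

theorem pow_le_mul_sup_span {I J : Ideal R} (hJI : J ≤ I)
    {n : ℕ} (h : (I.map (algebraMap R S)) ^ (n + 1)
      = J.map (algebraMap R S) * (I.map (algebraMap R S)) ^ n)
    (g : R) (hg : (g : S) ∈ C) (hgI : ∀ r : R, (g : S) ∣ (r : S) → r ∈ I) :
    I ^ (n + 2) ≤ J * I ^ (n + 1) ⊔ Ideal.span {g} := by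
  intro x hx
  have hxS : (x : S) ∈ (J * I ^ (n + 1)).map (algebraMap R S) := by
    rw [Ideal.map_mul, Ideal.map_pow, ← pow_succ_add_eq_mul h 1, ← Ideal.map_pow]
    exact Ideal.mem_map_of_mem _ hx
  obtain ⟨p, hp, w, -, hw⟩ := hT.exists_eq_add_mul_of_mem_map hg hxS
  have hpI : p ∈ I ^ (n + 2) := by
    rw [pow_succ' I (n + 1)]
    exact Ideal.mul_mono_left hJI hp
  obtain ⟨k, hk, hkx⟩ := hT.derivation_mem_of_mem_pow (n + 1) (sub_mem hx hpI)
  rw [h, ← Ideal.map_pow, ← Ideal.map_mul] at hk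
  obtain ⟨y, hy, s, k', hys, hyk⟩ := hT.exists_mem_mul_derivation_eq hg hgI hk
  rw [mul_assoc, ← pow_succ] at hy
  have hsub : (x : S) - p - y = g * (w - s) := by rw [hw, hys]; ring
  have hδ : δ (w - s) = ι (-k') := by
    refine smul_cancel hg ?_
    rw [← hT.leibniz_left hg, ← hsub, map_sub, hyk, hkx, AddSubgroupClass.coe_sub, map_neg, smul_neg]
    abel
  have hx' : x = p + y + g * ⟨w - s, hT.mem_iff'.2 ⟨_, hδ⟩⟩ := by
    refine Subtype.ext ?_
    push_cast
    rw [← hsub]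
    ring
  rw [hx']
  exact add_mem (Ideal.mem_sup_left (add_mem hp hy))
    (Ideal.mem_sup_right (Ideal.mul_mem_right _ _ (Ideal.mem_span_singleton_self g)))

/-- A reduction of `IS` extended from `J ⊆ I` comes with a reduction of `I`, at the cost of raising
the exponent by one. -/
theorem pow_eq_mul [IsLocalRing R] [IsNoetherianRing R] {I J : Ideal R} (hJI : J ≤ I)
    (hI : (I.map (algebraMap R S)).comap (algebraMap R S) = I)
    {c : R} (hcI : c ∈ I) (hcC : (c : S) ∈ C) (hc : c ∈ maximalIdeal R)
    {n : ℕ} (h : (I.map (algebraMap R S)) ^ (n + 1)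
      = J.map (algebraMap R S) * (I.map (algebraMap R S)) ^ n) :
    I ^ (n + 2) = J * I ^ (n + 1) := by
  refine le_antisymm (Ideal.le_of_le_sup_maximalIdeal_mul ?_) ?_
  -- The exponent `n + 3` puts `g` in `𝔪 I ^ (n + 2)`.
  · refine (hT.pow_le_mul_sup_span hJI h (c ^ (n + 3)) ?_ ?_).trans (sup_le_sup le_rfl ?_)
    · push_cast; exact pow_mem hcC _
    · intro r hr
      rw [← hI, Ideal.mem_comap]
      refine Ideal.mem_of_dvd _ ((dvd_pow_self (c : S) (n + 2).succ_ne_zero).trans ?_)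
        (Ideal.mem_map_of_mem (algebraMap R S) hcI)
      exact (Subring.coe_pow R c (n + 3)).symm ▸ hr
    · rw [Ideal.span_singleton_le_iff_mem, pow_succ' c (n + 2)]
      exact Ideal.mul_mem_mul hc (Ideal.pow_mem_pow hcI _)
  · rw [pow_succ' I (n + 1)]
    exact Ideal.mul_mono_left hJI

/-! ### Transfer of minimal reductions between `I` and `IS`. -/

variable [IsLocalRing S] [IsNoetherianRing S] [IsLocalRing R] [IsNoetherianRing R] {I : Ideal R}
  (hI : (I.map (algebraMap R S)).comap (algebraMap R S) = I)
  {c : R} (hcI : c ∈ I) (hcC : (c : S) ∈ C) (hc : (c : S) ∈ maximalIdeal S)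
include hI hcI hcC hc

theorem exists_isMinimalReduction_le {J : Ideal R} (hJI : J ≤ I) {L : Ideal S}
    (hL : IsMinimalReduction L (I.map (algebraMap R S))) (hLJ : L ≤ J.map (algebraMap R S)) :
    ∃ M ≤ J, IsMinimalReduction M I ∧
      IsMinimalReduction (M.map (algebraMap R S)) (I.map (algebraMap R S)) ∧
      ∀ n : ℕ, (I.map (algebraMap R S)) ^ (n + 1) = L * (I.map (algebraMap R S)) ^ n →
        I ^ (n + 2) = M * I ^ (n + 1) := by
  have hmem : ∀ r : R, (r : S) ∈ maximalIdeal S → r ∈ maximalIdeal R := fun r hr hu =>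
    hr (hu.map (algebraMap R S))
  have hcc : (c * c : S) ∈ C := mul_mem hcC hcC
  have hcIS : (c : S) ∈ I.map (algebraMap R S) := Ideal.mem_map_of_mem _ hcI
  have hccmem : ∀ w : S, (c * c : S) * w ∈ maximalIdeal S * I.map (algebraMap R S) := fun w =>
    Ideal.mul_mem_right _ _ (Ideal.mul_mem_mul hc hcIS)
  obtain ⟨l, f, rfl, hf⟩ := hL.exists_generators
  have hex := fun i => hT.exists_eq_add_mul_of_mem_map hcc (hLJ (Ideal.subset_span ⟨i, rfl⟩ :
    f i ∈ Ideal.span (Set.range f)))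
  choose p hpJ w _ hfp using hex
  have hsub : ∀ i, f i - (p i : S) ∈ maximalIdeal S * I.map (algebraMap R S) := fun i => by
    rw [hfp, add_sub_cancel_left]; exact hccmem _
  have hMJ : Ideal.span (Set.range p) ≤ J := Ideal.span_le.2 (Set.range_subset_iff.2 hpJ)
  have hmap : (Ideal.span (Set.range p)).map (algebraMap R S)
      = Ideal.span (Set.range fun i => (p i : S)) := by
    rw [Ideal.map_span, ← Set.range_comp]; rfl
  have hp := hf.congr hsub
  have hpIS : ∀ i, (p i : S) ∈ I.map (algebraMap R S) := fun i =>
    Ideal.mem_map_of_mem _ (hJI (hpJ i))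
  have hMS := hL.span_of_sub_mem hf hpIS hsub
  have hpow : ∀ n : ℕ, (I.map (algebraMap R S)) ^ (n + 1)
      = Ideal.span (Set.range f) * (I.map (algebraMap R S)) ^ n →
        I ^ (n + 2) = Ideal.span (Set.range p) * I ^ (n + 1) := fun n hn => by
    refine hT.pow_eq_mul (hMJ.trans hJI) hI hcI hcC (hmem c hc) ?_
    rw [hmap]
    exact pow_eq_mul_of_le_sup (Ideal.span_le.2 (Set.range_subset_iff.2 hpIS))
      (span_range_le_sup_of_sub_mem hsub) hn
  have hMI : IsReduction (Ideal.span (Set.range p)) I := by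
    obtain ⟨n, -, hn⟩ := hL.1.2
    exact .of_pow_eq (hMJ.trans hJI) (hpow n hn)
  refine ⟨_, hMJ, ⟨hMI, fun N hN => le_antisymm hN.1 ?_⟩, hmap ▸ hMS, hpow⟩
  -- Minimality over `S` forces `NS = MS`. Each `p i` then agrees with some `q ∈ N` modulo `c²S`,
  -- and independence over `S` puts the coefficients of `p i - q` in `𝔪_R`.
  have hNS : N.map (algebraMap R S) = Ideal.span (Set.range fun i => (p i : S)) :=
    hMS.eq_of_le (hmap ▸ Ideal.map_mono hN.1) ((hN.trans hMI).map _)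
  refine Ideal.le_of_le_sup_maximalIdeal_mul (Ideal.span_le.2 ?_)
  rintro _ ⟨i, rfl⟩
  have hpi : (p i : S) ∈ N.map (algebraMap R S) := hNS ▸ Ideal.subset_span ⟨i, rfl⟩
  obtain ⟨q, hq, v, -, hqv⟩ := hT.exists_eq_add_mul_of_mem_map hcc hpi
  obtain ⟨b, hb⟩ := Ideal.mem_span_range_iff_exists_fun.1
    (sub_mem (Ideal.subset_span ⟨i, rfl⟩) (hN.1 hq) : p i - q ∈ Ideal.span (Set.range p))
  have hbS : ∑ j, (b j : S) * p j ∈ maximalIdeal S * I.map (algebraMap R S) := by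
    have := congrArg (algebraMap R S) hb
    simp only [map_sum, map_mul, map_sub] at this
    have hrw : ∑ j, (b j : S) * p j = (c * c : S) * v := by
      refine Eq.trans this ?_
      change (p i : S) - q = _
      rw [hqv, add_sub_cancel_left]
    exact hrw ▸ hccmem v
  rw [← add_sub_cancel q (p i), ← hb]
  exact add_mem (Ideal.mem_sup_left hq) (Ideal.mem_sup_right (sum_mem fun j _ =>
    Ideal.mul_mem_mul (hmem _ (hp _ hbS j)) (Ideal.subset_span ⟨j, rfl⟩)))

/-- A minimal reduction of `IS` inside `JS` descends to a reduction of `I` inside `J`, which must be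
`J` itself. -/
theorem isMinimalReduction_map {J : Ideal R} (hJ : IsMinimalReduction J I) :
    IsMinimalReduction (J.map (algebraMap R S)) (I.map (algebraMap R S)) := by
  obtain ⟨L, hLJ, hL⟩ := (hJ.1.map (algebraMap R S)).exists_isMinimalReduction_le
  obtain ⟨M, hMJ, hM, hMS, -⟩ := hT.exists_isMinimalReduction_le hI hcI hcC hc hJ.1.1 hL hLJ
  rwa [hJ.eq_of_le hMJ hM.1] at hMS

end TwistsAlong

theorem corollary3p4 {S : Type*} [CommRing S] [IsLocalRing S] [IsNoetherianRing S]
    [Infinite (IsLocalRing.ResidueField S)]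
    {K : Type*} [AddCommGroup K] [Module S K] (C : Submonoid S)
    (R : Subring S) (hR : IsTwistedAlong K C R)
    [IsLocalRing R] [IsNoetherianRing R] [Infinite (IsLocalRing.ResidueField R)]
    (I : Ideal R)
    (hcontracted : (I.map (algebraMap R S)).comap (algebraMap R S) = I)
    (hmeets : ∃ x ∈ I, (x : S) ∈ C) :
    (∀ (J : Ideal S) (n : ℕ), IsMinimalReduction J (I.map (algebraMap R S)) →
      (I.map (algebraMap R S)) ^ (n + 1) = J * (I.map (algebraMap R S)) ^ n →
      ∃ J' : Ideal R, IsMinimalReduction J' I ∧ I ^ (n + 2) = J' * I ^ (n + 1)) ∧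
    -- the minima defining `r_S(IS)` and `r_R(I)` are over nonempty sets
    (∃ J : Ideal S, IsMinimalReduction J (I.map (algebraMap R S))) ∧
    (∃ J' : Ideal R, IsMinimalReduction J' I) ∧
    reductionNumber (I.map (algebraMap R S)) ≤ reductionNumber I ∧
    reductionNumber I ≤ reductionNumber (I.map (algebraMap R S)) + 1 := by
  obtain ⟨D, hT⟩ := hR
  obtain ⟨c, hcI, hcC⟩ := hmeets
  -- If `c` is a unit, then `I` and `IS` are unit ideals and both numbers are `0`.
  by_cases hc : IsUnit (c : S)
  · have htop : I.map (algebraMap R S) = ⊤ :=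
      Ideal.eq_top_of_isUnit_mem _ (Ideal.mem_map_of_mem (algebraMap R S) hcI) hc
    obtain rfl : I = ⊤ := by rw [← hcontracted, htop, Ideal.comap_top]
    rw [htop, reductionNumber_top, reductionNumber_top]
    exact ⟨fun J n _ _ => ⟨⊤, isMinimalReduction_top, by simp [Ideal.top_pow]⟩, ⟨⊤, isMinimalReduction_top⟩,
      ⟨⊤, isMinimalReduction_top⟩, le_rfl, Nat.zero_le _⟩
  · have hlift : ∀ (J : Ideal S) (n : ℕ), IsMinimalReduction J (I.map (algebraMap R S)) →
        (I.map (algebraMap R S)) ^ (n + 1) = J * (I.map (algebraMap R S)) ^ n →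
        ∃ J' : Ideal R, IsMinimalReduction J' I ∧ I ^ (n + 2) = J' * I ^ (n + 1) := by
      intro J n hJ hn
      obtain ⟨M, -, hM, -, h⟩ :=
        hT.exists_isMinimalReduction_le hcontracted hcI hcC hc le_rfl hJ hJ.1.1
      exact ⟨M, hM, h n hn⟩
    have hexS : ∃ J : Ideal S, IsMinimalReduction J (I.map (algebraMap R S)) :=
      (IsReduction.refl _).exists_isMinimalReduction_le.imp fun _ h => h.2
    have hexR : ∃ J : Ideal R, IsMinimalReduction J I :=
      (IsReduction.refl _).exists_isMinimalReduction_le.imp fun _ h => h.2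
    refine ⟨hlift, hexS, hexR, ?_, ?_⟩
    · obtain ⟨J, hJ, h⟩ := exists_pow_reductionNumber_eq hexR
      refine reductionNumber_le (hT.isMinimalReduction_map hcontracted hcI hcC hc hJ) ?_
      rw [← Ideal.map_pow, h, Ideal.map_mul, Ideal.map_pow]
    · obtain ⟨J, hJ, h⟩ := exists_pow_reductionNumber_eq hexS
      obtain ⟨J', hJ', h'⟩ := hlift J _ hJ h
      exact reductionNumber_le hJ' h'
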